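/- **Conventions.** Algebras are complex and need not be unital; a projection is a self-adjoint idempotent. For a nonempty subset $S$ of a $*$-algebra $A$ let $R(S)=\{x\in A: sx=0\ \forall s\in S\}$. $A$ is a *Baer $*$-algebra* if for each nonempty $S\subseteq A$ there is a projection $g$ with $R(S)=gA$ (such an $A$ is unital). A $*$-subalgebra $B$ of $A$ is a *Baer $*$-subalgebra* if for each nonempty $S\subseteq B$ there is a projection $p\in B$ with $R(S)=\{x\in A:px=0\}=(1-p)A$, i.e. the right support of $S$ in $A$ lies in $B$. An *$AW^*$-algebra* is a $C^*$-algebra that is a Baer $*$-algebra; an *$AW^*$-subalgebra* of it is a norm closed $*$-subalgebra that is a Baer $*$-subalgebra. A topological $*$-algebra $A$ is a *locally $C^*$-algebra* if it is topologically $*$-isomorphic to the projective limit (the set of coherent families in the product, with the product topology) of a projective family of $C^*$-algebras $A_\alpha$ and $*$-homomorphisms $g_\alpha^\beta:A_\beta\to A_\alpha$ ($\alpha\preceq\beta$) over a directed set $\Lambda$; it is a *locally $AW^*$-algebra* if moreover it is a Baer $*$-algebra. A *locally $AW^*$-subalgebra* is a $*$-subalgebra that is a locally $C^*$-algebra in the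 induced topology and a Baer $*$-subalgebra. An *Arens–Michael decomposition* of $A$ is a realization $A\cong\varprojlim A_\alpha$ of this kind in which all the natural projections $\pi_\alpha:A\to A_\alpha$ are surjective. For $*$-subalgebras $B\subseteq A$, $C_\alpha\subseteq A_\alpha$, we write $B\cong\varprojlim C_\alpha$ if $g_\alpha^\beta(C_\beta)\subseteq C_\alpha$ for $\alpha\preceq\beta$, $\pi_\alpha(B)\subseteq C_\alpha$ for all $\alpha$, and the restricted maps $\pi_\alpha|_B$, $g_\alpha^\beta|_{C_\beta}$ realize $B$ (with the induced topology) as the projective limit of the $C_\alpha$. **Theorem 2.** Let $A$ be a locally $AW^*$-algebra. Then 1. the center $Z$ of $A$, each maximal commutative $*$-subalgebra $B$ of $A$, and each corner $eAe$ ($e$ a projection in $A$) are locally $AW^*$-subalgebras of $A$. 2. Let $A\cong\varprojlim A_\alpha$ be any Arens–Michael decomposition of $A$. (a) $\pi_\alpha(Z)$ is the center $Z_\alpha$ of $A_\alpha$ for each $\alpha$, $Z_\alpha$ is an $AW^*$-subalgebra of $A_\alpha$ whenever $A_\alpha$ is an $AW^*$-algebra, and $Z\cong\varprojlim Z_\alpha$.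 (b) Let $B$ be a maximal commutative $*$-subalgebra of $A$ and $B_\alpha=\pi_\alpha(B)$. Each $B_\alpha$ is norm closed in $A_\alpha$, and $B\cong\varprojlim B_\alpha$. The commutant $B_\alpha'$ of $B_\alpha$ in $A_\alpha$ is an $AW^*$-subalgebra of $A_\alpha$ whenever $A_\alpha$ is an $AW^*$-algebra, and $B\cong\varprojlim B_\alpha'$. Moreover, if for each $\alpha$ any maximal commutative $*$-subalgebra $C_\alpha\supseteq B_\alpha$ of $A_\alpha$ is chosen, then $C_\alpha$ is an $AW^*$-subalgebra of $A_\alpha$ whenever $A_\alpha$ is an $AW^*$-algebra, and $B=\{x\in A:\pi_\alpha(x)\in C_\alpha\ \forall\alpha\}$. (c) For each projection $e\in A$, with $e_\alpha=\pi_\alpha(e)$: $\pi_\alpha(eAe)=e_\alpha A_\alpha e_\alpha$ for each $\alpha$, this is an $AW^*$-subalgebra of $A_\alpha$ whenever $A_\alpha$ is an $AW^*$-algebra, and $eAe\cong\varprojlim e_\alpha A_\alpha e_\alpha$. -/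

import Mathlib

universe u v w

/-- The right annihilator `R(S) = {x : s x = 0 for all s ∈ S}` of a subset `S`. -/
def rightAnnihilator {A : Type*} [NonUnitalRing A] (S : Set A) : Set A :=
  {x | ∀ s ∈ S, s * x = 0}

/-- A Baer `*`-algebra: the right annihilator of each nonempty subset is of the form `g A`
with `g` a projection (a self-adjoint idempotent). -/
def IsBaerStar (A : Type*) [NonUnitalRing A] [StarRing A] : Prop :=
  ∀ S : Set A, S.Nonempty →
    ∃ g : A, IsStarProjection g ∧ rightAnnihilator S = {x | ∃ a, x = g * a}

section Subalgebras

variable {A : Type*} [NonUnitalRing A] [StarRing A] [Module ℂ A] [IsScalarTower ℂ A A]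
  [SMulCommClass ℂ A A] [StarModule ℂ A]

/-- A Baer `*`-subalgebra `B` of a Baer `*`-algebra `A`: for each nonempty `S ⊆ B` the right
annihilator of `S` in `A` is `(1 - p) A` with a projection `p` in `B`, that is, the right support
of `S` computed in `A` belongs to `B`. The set `(1 - p) A` is written as `{x | p x = 0}`, so that
the unit of `A` need not be named; `B` need not contain the unit of `A`. -/
def IsBaerStarSubalgebra (B : NonUnitalStarSubalgebra ℂ A) : Prop :=
  ∀ S : Set A, S ⊆ B → S.Nonempty →
    ∃ p ∈ B, IsStarProjection p ∧ rightAnnihilator S = {x | p * x = 0}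

/-- `B` is maximal among the commutative `*`-subalgebras of `A`. -/
def IsMaximalCommutative (B : NonUnitalStarSubalgebra ℂ A) : Prop :=
  Maximal (fun C : NonUnitalStarSubalgebra ℂ A => ∀ x ∈ C, ∀ y ∈ C, x * y = y * x) B

/-- The corner `e A e` of a projection `e`. -/
def starCorner (e : A) (he : IsStarProjection e) : NonUnitalStarSubalgebra ℂ A where
  carrier := {x | ∃ a, x = e * a * e}
  add_mem' := by
    rintro _ _ ⟨a, rfl⟩ ⟨b, rfl⟩
    exact ⟨a + b, by rw [mul_add, add_mul]⟩
  zero_mem' := ⟨0, by simp⟩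
  mul_mem' := by
    rintro _ _ ⟨a, rfl⟩ ⟨b, rfl⟩
    exact ⟨a * e * (e * b), by simp only [mul_assoc]⟩
  smul_mem' := by
    rintro c _ ⟨a, rfl⟩
    exact ⟨c • a, by rw [mul_smul_comm, smul_mul_assoc]⟩
  star_mem' := by
    rintro _ ⟨a, rfl⟩
    exact ⟨star a, by simp only [star_mul, he.isSelfAdjoint.star_eq, mul_assoc]⟩

end Subalgebras

/-- A realization of the topological `*`-algebra `A` as the projective limit of a projective family
`F α`, `α ∈ Λ`, of topological `*`-algebras: connecting `*`-homomorphisms `g α β : F β → F α` for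
`α ≤ β`, and projections `π α : A → F α` such that `x ↦ (π α x)` is a homeomorphism of `A` onto the
set of all coherent families in the product `∏ F α`. -/
structure ProjectiveLimit (A : Type*) [NonUnitalRing A] [StarRing A] [Module ℂ A]
    [TopologicalSpace A] {Λ : Type*} [PartialOrder Λ] (F : Λ → Type*)
    [∀ α, NonUnitalRing (F α)] [∀ α, StarRing (F α)] [∀ α, Module ℂ (F α)]
    [∀ α, TopologicalSpace (F α)] where
  g : ∀ α β : Λ, α ≤ β → F β →⋆ₙₐ[ℂ] F α
  g_continuous : ∀ α β (h : α ≤ β), Continuous (g α β h)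
  g_refl : ∀ α (x : F α), g α α le_rfl x = x
  g_comp : ∀ α β γ (h : α ≤ β) (k : β ≤ γ) (x : F γ), g α β h (g β γ k x) = g α γ (h.trans k) x
  π : ∀ α : Λ, A →⋆ₙₐ[ℂ] F α
  g_π : ∀ α β (h : α ≤ β) (a : A), g α β h (π β a) = π α a
  isEmbedding : Topology.IsEmbedding (fun (a : A) (α : Λ) => π α a)
  exists_lift : ∀ x : (α : Λ) → F α, (∀ α β (h : α ≤ β), g α β h (x β) = x α) →
    ∃ a : A, ∀ α, π α a = x α

/-- A locally `C*`-algebra: a topological `*`-algebra that is topologically `*`-isomorphic to the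
projective limit of a projective family of `C*`-algebras over a directed set. -/
def IsLocallyCStar (A : Type u) [NonUnitalRing A] [StarRing A] [Module ℂ A]
    [TopologicalSpace A] : Prop :=
  ∃ (Λ : Type u) (_ : PartialOrder Λ) (_ : IsDirectedOrder Λ) (F : Λ → Type u)
    (_ : ∀ α, NonUnitalCStarAlgebra (F α)), Nonempty (ProjectiveLimit A F)

/-- A locally `AW*`-algebra: a locally `C*`-algebra that is a Baer `*`-algebra. -/
def IsLocallyAWStar (A : Type u) [NonUnitalRing A] [StarRing A] [Module ℂ A]
    [TopologicalSpace A] : Prop :=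
  IsLocallyCStar A ∧ IsBaerStar A

/-- A locally `AW*`-subalgebra: a `*`-subalgebra that is a locally `C*`-algebra in the induced
topology and a Baer `*`-subalgebra. -/
def IsLocallyAWStarSubalgebra {A : Type u} [NonUnitalRing A] [StarRing A] [Module ℂ A]
    [IsScalarTower ℂ A A] [SMulCommClass ℂ A A] [StarModule ℂ A] [TopologicalSpace A]
    (B : NonUnitalStarSubalgebra ℂ A) : Prop :=
  IsLocallyCStar B ∧ IsBaerStarSubalgebra B

/-- An `AW*`-algebra: a `C*`-algebra that is a Baer `*`-algebra. -/
def IsAWStar (A : Type*) [NonUnitalCStarAlgebra A] : Prop :=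
  IsBaerStar A

/-- An `AW*`-subalgebra of an `AW*`-algebra: a `C*`-subalgebra (a norm closed `*`-subalgebra) that
is a Baer `*`-subalgebra. -/
def IsAWStarSubalgebra {A : Type*} [NonUnitalCStarAlgebra A]
    (B : NonUnitalStarSubalgebra ℂ A) : Prop :=
  IsClosed (B : Set A) ∧ IsBaerStarSubalgebra B

/-- The `*`-subalgebra `B` of `A = lim F α` is the projective limit of the `*`-subalgebras `C α` of
the factors `F α`, with the connecting maps and the projections of `A` restricted. -/
def ProjectiveLimit.RestrictsTo {A : Type*} [NonUnitalRing A] [StarRing A] [Module ℂ A]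
    [TopologicalSpace A] {Λ : Type*} [PartialOrder Λ] {F : Λ → Type*}
    [∀ α, NonUnitalCStarAlgebra (F α)] (D : ProjectiveLimit A F)
    (B : NonUnitalStarSubalgebra ℂ A) (C : ∀ α, NonUnitalStarSubalgebra ℂ (F α)) : Prop :=
  ∃ E : ProjectiveLimit B (fun α => C α),
    (∀ α β (h : α ≤ β) (x : C β), (E.g α β h x : F α) = D.g α β h x) ∧
    ∀ α (b : B), (E.π α b : F α) = D.π α b

/-! The algebraic half rests on right supports: the right support of `S` commutes with whatever
commutes, along with its adjoint, with `S`. Hence every commutant is a Baer `*`-subalgebra. The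
center is the commutant of everything and a maximal commutative `*`-subalgebra is its own commutant,
so both are covered; corners are checked directly. Commutation and `e x e = x` are closed conditions
that can be tested factor by factor, which gives the projective limit descriptions.

Two analytic facts remain. First, images of commutants in a factor are closed
(`isClosed_map_centralizer`): approximants in `A` are corrected by increments truncated by
functional calculus, which leaves them unchanged in the given factor and makes them summable in all
factors at once.

Second, every central element of a factor lifts to a central element (`map_center`). Lift a positive
central `z` to a self-adjoint `x`, and let `e ≤ q` be supports of functions of `x` living on `[2s,
∞)` and `[s, ∞)`. Comparison of `e` with `1 - q` (`IsBaerStar.exists_comparison`) yields a partial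
isometry `w` and a central projection `c` separating what `w` leaves over. A function of `z` is
central, acts as the identity on the image of `e` and kills that of `1 - q`, so `w` maps to `0`, and
the image of `c` lies between those of `e` and `q`. Subtracting `s` times it from `z` cuts a norm
bound `3s` to `2s`. Iteration and closedness of the image finish the argument.

Comparison needs partial isometries in nonzero corners, obtained by a truncated polar decomposition,
and sums of orthogonal partial isometries, obtained from the support of their graph projections. -/

section Support

/-! ### Right supports, sums of partial isometries, and comparison of projections. -/

variable {A : Type*} [NonUnitalRing A] [StarRing A]

/-- `p` is the right support of `S`: the smallest projection with `s p = s` for all `s ∈ S`. -/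
structure IsRightSupport (S : Set A) (p : A) : Prop where
  proj : IsStarProjection p
  mul_eq : ∀ s ∈ S, s * p = s
  mul_eq_zero : ∀ x, (∀ s ∈ S, s * x = 0) → p * x = 0

theorem IsStarProjection.mul_self_eq {p : A} (hp : IsStarProjection p) : p * p = p :=
  hp.isIdempotentElem

theorem IsStarProjection.star_self_eq {p : A} (hp : IsStarProjection p) : star p = p :=
  hp.isSelfAdjoint

theorem IsStarProjection.mul_mul_self {p : A} (hp : IsStarProjection p) (x : A) :
    p * (p * x) = p * x := by rw [← mul_assoc, hp.mul_self_eq]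

namespace IsRightSupport

variable {S : Set A} {p : A}

theorem mul_congr (h : IsRightSupport S p) {x y : A} (hxy : ∀ s ∈ S, s * x = s * y) :
    p * x = p * y := by
  rw [← sub_eq_zero, ← mul_sub]
  exact h.mul_eq_zero _ fun s hs => by rw [mul_sub, hxy s hs, sub_self]

theorem mul_right_eq (h : IsRightSupport S p) {x : A} (hx : ∀ s ∈ S, s * x = s) :
    p * x = p := by
  rw [h.mul_congr (x := x) (y := p) fun s hs => (hx s hs).trans (h.mul_eq s hs).symm,
    h.proj.mul_self_eq]

theorem rightAnnihilator_eq (h : IsRightSupport S p) :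
    rightAnnihilator S = {x | p * x = 0} := by
  ext x
  refine ⟨h.mul_eq_zero x, fun (hx : p * x = 0) s hs => ?_⟩
  rw [← h.mul_eq s hs, mul_assoc, hx, mul_zero]

/-- The right support commutes with every `t` that commutes, together with its adjoint,
with `S`. -/
theorem commute (h : IsRightSupport S p) {t : A} (ht : ∀ s ∈ S, s * t = t * s)
    (ht' : ∀ s ∈ S, s * star t = star t * s) : p * t = t * p := by
  have key : ∀ t : A, (∀ s ∈ S, s * t = t * s) → p * t * p = p * t := fun t ht => by
    rw [mul_assoc]
    exact h.mul_congr fun s hs => by rw [← mul_assoc, ht s hs, mul_assoc, h.mul_eq s hs]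
  -- Applying `key` to `star t` and taking adjoints gives `p t p = t p`; compare with `p t p = p t`.
  have h1 := key t ht
  have h2 := congrArg star (key _ ht')
  simp only [star_mul, star_star, h.proj.star_self_eq] at h2
  rw [← h1, ← h2, mul_assoc]

end IsRightSupport

namespace IsBaerStar

theorem exists_unit (hA : IsBaerStar A) :
    ∃ u : A, IsStarProjection u ∧ ∀ a, u * a = a ∧ a * u = a := by
  obtain ⟨u, hu, h⟩ := hA {0} ⟨0, rfl⟩
  have hl : ∀ a, u * a = a := fun a => by
    have : a ∈ rightAnnihilator ({0} : Set A) := by simp [rightAnnihilator]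
    rw [h] at this
    obtain ⟨b, rfl⟩ := this
    exact hu.mul_mul_self b
  refine ⟨u, hu, fun a => ⟨hl a, ?_⟩⟩
  simpa [hu.star_self_eq] using congrArg star (hl (star a))

theorem exists_isRightSupport (hA : IsBaerStar A) (S : Set A) : ∃ p, IsRightSupport S p := by
  obtain ⟨u, hu, h1⟩ := hA.exists_unit
  -- Adjoining `0` does not change the annihilator and makes the empty set admissible.
  obtain ⟨g, hg, h⟩ := hA (insert 0 S) ⟨0, Set.mem_insert _ _⟩
  refine ⟨u - g, ⟨?_, ?_⟩, fun s hs => ?_, fun x hx => ?_⟩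
  · simp only [IsIdempotentElem, mul_sub, sub_mul, hg.mul_self_eq, h1]
    simp
  · simp [IsSelfAdjoint, hu.star_self_eq, hg.star_self_eq]
  · have : g ∈ rightAnnihilator (insert 0 S) := by rw [h]; exact ⟨g, hg.mul_self_eq.symm⟩
    rw [mul_sub, (h1 s).2, this s (Set.mem_insert_of_mem _ hs), sub_zero]
  · have : x ∈ rightAnnihilator (insert 0 S) := by
      rintro s (rfl | hs)
      exacts [zero_mul x, hx s hs]
    rw [h] at this
    obtain ⟨a, rfl⟩ := this
    rw [sub_mul, (h1 _).1, hg.mul_mul_self, sub_self]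

end IsBaerStar

/-- Every nonzero corner `f A e` contains a nonzero partial isometry. -/
def HasPartialIsometries (A : Type*) [NonUnitalRing A] [StarRing A] : Prop :=
  ∀ e f : A, IsStarProjection e → IsStarProjection f → (∃ a, f * a * e ≠ 0) →
    ∃ v, v ≠ 0 ∧ f * v = v ∧ v * e = v ∧ v * star v * v = v

/-- A family of nonzero partial isometries in `f A e` with pairwise orthogonal initial
and final projections. -/
def IsOrthogonalPartialIsometryFamily (e f : A) (V : Set A) : Prop :=
  (∀ v ∈ V, v ≠ 0 ∧ f * v = v ∧ v * e = v ∧ v * star v * v = v) ∧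
    ∀ v ∈ V, ∀ w ∈ V, v ≠ w → v * star w = 0 ∧ star v * w = 0

/-- Orthogonal partial isometries between two orthogonal projections can be added up. -/
theorem IsOrthogonalPartialIsometryFamily.exists_sum (hA : IsBaerStar A) {e f : A}
    (he : IsStarProjection e) (hf : IsStarProjection f) (hef : e * f = 0) {V : Set A}
    (hV : IsOrthogonalPartialIsometryFamily e f V) :
    ∃ w e' : A, IsStarProjection e' ∧ e' * e = e' ∧ f * w = w ∧ star w * w = e' ∧ w * e' = w ∧
      ∀ v ∈ V, v * e' = v ∧ w * star w * v = v := by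
  have hfe : f * e = 0 := by
    simpa [he.star_self_eq, hf.star_self_eq] using congrArg star hef
  obtain ⟨hV1, hV2⟩ := hV
  have vv : ∀ v ∈ V, ∀ w ∈ V, v * w = 0 := fun v hv w hw => by
    rw [← (hV1 v hv).2.2.1, ← (hV1 w hw).2.1, mul_assoc, ← mul_assoc e, hef, zero_mul, mul_zero]
  have vv' : ∀ v ∈ V, ∀ w ∈ V, star v * star w = 0 := fun v hv w hw => by
    rw [← star_mul, vv w hw v hv, star_zero]
  have v3 : ∀ v ∈ V, v * (star v * v) = v := fun v hv => by
    rw [← mul_assoc]; exact (hV1 v hv).2.2.2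
  have v3' : ∀ v ∈ V, star v * (v * star v) = star v := fun v hv => by
    simpa [mul_assoc] using congrArg star (v3 v hv)
  -- Since `v * v = 0`, `E v` is the projection onto initial plus final space and half of `q v`
  -- would be the projection onto the graph of `v`. A ring need not allow halving, so the identities
  -- carry a factor `2`.
  let E : A → A := fun v => star v * v + v * star v
  let q : A → A := fun v => E v + (v + star v)
  have hqstar : ∀ v, star (q v) = q v := fun v => by simp [q, E]; abel
  have hqE : ∀ v ∈ V, q v * q v = 2 • (q v * E v) := fun v hv => by
    have a1 := vv v hv v hv
    have a2 := vv' v hv v hv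
    have a3 := v3 v hv
    have a4 := v3' v hv
    have a5 : ∀ x, v * (v * x) = 0 := fun x => by rw [← mul_assoc, a1, zero_mul]
    have a6 : ∀ x, star v * (star v * x) = 0 := fun x => by rw [← mul_assoc, a2, zero_mul]
    simp only [q, E, mul_add, add_mul, mul_assoc, a1, a2, a3, a4, a5, a6, mul_zero]
    abel
  have hqq : ∀ v ∈ V, ∀ w ∈ V, v ≠ w → q v * q w = 2 • (q v * E w) := fun v hv w hw hvw => by
    have a1 := vv v hv w hw
    have a2 := vv' v hv w hw
    obtain ⟨a3, a4⟩ := hV2 v hv w hw hvw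
    have a5 : ∀ x, v * (w * x) = 0 := fun x => by rw [← mul_assoc, a1, zero_mul]
    have a6 : ∀ x, star v * (star w * x) = 0 := fun x => by rw [← mul_assoc, a2, zero_mul]
    have a7 : ∀ x, v * (star w * x) = 0 := fun x => by rw [← mul_assoc, a3, zero_mul]
    have a8 : ∀ x, star v * (w * x) = 0 := fun x => by rw [← mul_assoc, a4, zero_mul]
    simp only [q, E, mul_add, add_mul, mul_assoc, a1, a2, a3, a4, a5, a6, a7, a8, mul_zero]
    simp
  -- The supremum of all the graph projections; below each `E v` it reduces to the graph of `v`, so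
  -- twice its corner `f p e` acts as `v` on the initial space of each `v`.
  obtain ⟨p, hp⟩ := hA.exists_isRightSupport (q '' V)
  have hpE : ∀ v ∈ V, 2 • (p * E v) = q v := fun v hv => by
    have h1 : p * q v = q v := by
      simpa [hqstar, hp.proj.star_self_eq] using congrArg star (hp.mul_eq _ ⟨v, hv, rfl⟩)
    rw [← h1, ← mul_smul_comm]
    refine (hp.mul_congr ?_).symm
    rintro _ ⟨u, hu, rfl⟩
    rw [mul_smul_comm]
    by_cases huv : u = v
    · subst huv; exact hqE _ hv
    · exact hqq u hu v hv huv
  have sve : ∀ v ∈ V, e * star v = star v := fun v hv => by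
    simpa [he.star_self_eq] using congrArg star (hV1 v hv).2.2.1
  have fsv : ∀ v ∈ V, f * star v = 0 := fun v hv => by
    rw [← sve v hv, ← mul_assoc, hfe, zero_mul]
  have ev : ∀ v ∈ V, e * v = 0 := fun v hv => by
    rw [← (hV1 v hv).2.1, ← mul_assoc, hef, zero_mul]
  have Ev : ∀ v ∈ V, E v * (star v * v) = star v * v := fun v hv => by
    simp only [E, add_mul, mul_assoc, v3 v hv]
    rw [← mul_assoc (star v) (star v), vv' v hv v hv]; simp
  have Ev' : ∀ v ∈ V, E v * (v * star v) = v * star v := fun v hv => by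
    simp only [E, add_mul, mul_assoc, v3' v hv]
    rw [← mul_assoc v v, vv v hv v hv]; simp
  set w := 2 • (f * p * e) with hw
  have hsw : star w = 2 • (e * p * f) := by
    simp [hw, he.star_self_eq, hf.star_self_eq, hp.proj.star_self_eq, mul_assoc]
  have hwv : ∀ v ∈ V, w * (star v * v) = v := fun v hv => by
    have : w * (star v * v) = f * (2 • (p * E v)) * (star v * v) := by
      simp only [hw, smul_mul_assoc, mul_smul_comm, mul_assoc, Ev v hv]
      rw [← mul_assoc e, sve v hv]
    rw [this, hpE v hv]
    simp only [q, E, add_mul, mul_add, mul_assoc, v3 v hv, (hV1 v hv).2.1]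
    rw [← mul_assoc (star v) (star v), vv' v hv v hv, ← mul_assoc f (star v), fsv v hv]
    simp only [zero_mul, mul_zero]
    simp
  have hwv' : ∀ v ∈ V, star w * v = star v * v := fun v hv => by
    have : star w * (v * star v) = e * (2 • (p * E v)) * (v * star v) := by
      simp only [hsw, smul_mul_assoc, mul_smul_comm, mul_assoc, Ev' v hv]
      rw [← mul_assoc f, (hV1 v hv).2.1]
    rw [hpE v hv] at this
    have h2 : star w * (v * star v) = star v := by
      rw [this]
      simp only [q, E, add_mul, mul_add, mul_assoc, v3' v hv, sve v hv]
      rw [← mul_assoc v v, vv v hv v hv, ← mul_assoc e v, ev v hv]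
      simp
    conv_lhs => rw [← v3 v hv]
    rw [← mul_assoc v, ← mul_assoc, h2]
  -- Nothing makes `w` isometric beyond the initial spaces of the `v`, so it is cut down to the
  -- support of their projections.
  obtain ⟨e', he'⟩ := hA.exists_isRightSupport ((fun v => star v * v) '' V)
  have hww : e' * (star w * w) = e' := he'.mul_right_eq <| by
    rintro _ ⟨v, hv, rfl⟩
    have h1 : star v * v * star w = star v := by
      simpa [mul_assoc] using congrArg star (hwv v hv)
    have h2 : star v * w = star v * v := by
      simpa [mul_assoc] using congrArg star (hwv' v hv)
    simp only
    rw [← mul_assoc, h1, h2]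
  have hve : ∀ v ∈ V, v * e' = v := fun v hv => by
    conv_lhs => rw [← v3 v hv]
    rw [mul_assoc, he'.mul_eq _ ⟨v, hv, rfl⟩, v3 v hv]
  have hmain : star (w * e') * (w * e') = e' := by
    rw [star_mul, he'.proj.star_self_eq, mul_assoc, ← mul_assoc (star w), ← mul_assoc e', hww,
      he'.proj.mul_self_eq]
  refine ⟨w * e', e', he'.proj, he'.mul_right_eq ?_, ?_, hmain, ?_, fun v hv => ⟨hve v hv, ?_⟩⟩
  · rintro _ ⟨v, hv, rfl⟩
    simp only [mul_assoc, (hV1 v hv).2.2.1]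
  · simp only [hw, smul_mul_assoc, mul_smul_comm, mul_assoc, hf.mul_mul_self]
  · rw [mul_assoc, he'.proj.mul_self_eq]
  · have h1 : w * e' * (star v * v) = v := by
      have : e' * (star v * v) = star v * v := by
        simpa [he'.proj.star_self_eq, mul_assoc] using
          congrArg star (he'.mul_eq _ ⟨v, hv, rfl⟩)
      rw [mul_assoc, this, hwv v hv]
    conv_lhs => rw [← h1]
    rw [← mul_assoc, mul_assoc (w * e') _ (w * e'), hmain, mul_assoc w, he'.proj.mul_self_eq, h1]

theorem IsStarProjection.sub_of_mul_eq {p q : A} (hp : IsStarProjection p)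
    (hq : IsStarProjection q) (h : q * p = q) : IsStarProjection (p - q) := by
  have h' : p * q = q := by
    simpa [hp.star_self_eq, hq.star_self_eq] using congrArg star h
  refine ⟨?_, hp.isSelfAdjoint.sub hq.isSelfAdjoint⟩
  simp [IsIdempotentElem, mul_sub, sub_mul, hp.mul_self_eq, hq.mul_self_eq, h, h']

/-- Comparison of orthogonal projections `e` and `f`: after removing equivalent subprojections
they are separated by a central projection. -/
theorem IsBaerStar.exists_comparison (hA : IsBaerStar A) (hPI : HasPartialIsometries A) {e f : A}
    (he : IsStarProjection e) (hf : IsStarProjection f) (hef : e * f = 0) :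
    ∃ w c : A, IsStarProjection c ∧ (∀ a, c * a = a * c) ∧ f * w = w ∧ w * e = w ∧
      (e - star w * w) * c = e - star w * w ∧ c * (f - w * star w) = 0 := by
  obtain ⟨V, hV⟩ := zorn_subset {V : Set A | IsOrthogonalPartialIsometryFamily e f V} <| by
    intro c hc hchain
    refine ⟨⋃₀ c, ⟨?_, ?_⟩, fun s hs => Set.subset_sUnion_of_mem hs⟩
    · rintro v ⟨s, hs, hv⟩
      exact (hc hs).1 v hv
    · rintro v ⟨s, hs, hv⟩ w ⟨t, ht, hw⟩ hvw
      rcases hchain.total hs ht with h | h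
      · exact (hc ht).2 v (h hv) w hw hvw
      · exact (hc hs).2 v hv w (h hw) hvw
  obtain ⟨w, e', he', hee, hfw, hsw, hwe, hv⟩ := hV.prop.exists_sum hA he hf hef
  have hsf : star w * f = star w := by
    simpa [hf.star_self_eq] using congrArg star hfw
  have hf' : IsStarProjection (w * star w) := by
    refine ⟨?_, IsSelfAdjoint.mul_star_self w⟩
    rw [IsIdempotentElem, mul_assoc, ← mul_assoc (star w), hsw, ← mul_assoc, hwe]
  have hP := he.sub_of_mul_eq he' hee
  have hQ := hf.sub_of_mul_eq hf' (by rw [mul_assoc, hsf])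
  -- A nonzero corner here would contain a partial isometry orthogonal to all of `V`, against
  -- maximality.
  have hzero : ∀ a, (f - w * star w) * a * (e - e') = 0 := by
    by_contra! hne
    obtain ⟨v, v0, h1, h2, h3⟩ := hPI _ _ hP hQ hne
    have hve : v * e' = 0 := by
      rw [← h2, mul_assoc, sub_mul, he'.mul_self_eq]
      have : e * e' = e' := by
        simpa [he.star_self_eq, he'.star_self_eq] using congrArg star hee
      rw [this, sub_self, mul_zero]
    have hwv : w * star w * v = 0 := by
      rw [← h1, ← mul_assoc, mul_sub, hf'.mul_self_eq, mul_assoc w, hsf, sub_self, zero_mul]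
    have o1 : ∀ u ∈ V, v * star u = 0 := fun u hu => by
      have := congrArg star (hv u hu).1
      rw [star_mul, he'.star_self_eq] at this
      rw [← this, ← mul_assoc, hve, zero_mul]
    have o2 : ∀ u ∈ V, star v * u = 0 := fun u hu => by
      have := congrArg star hwv
      rw [star_mul, hf'.star_self_eq, star_zero] at this
      rw [← (hv u hu).2, ← mul_assoc, this, zero_mul]
    have hmem : v ∈ V := hV.mem_of_prop_insert (x := v) <| by
      refine ⟨?_, ?_⟩
      · rintro u (rfl | hu)
        · refine ⟨v0, ?_, ?_, h3⟩
          · rw [← h1, ← mul_assoc, mul_sub, hf.mul_self_eq, ← mul_assoc, hfw]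
          · rw [← h2, mul_assoc, sub_mul, he.mul_self_eq, hee]
        · exact hV.prop.1 u hu
      · rintro u (rfl | hu) x (rfl | hx) hux
        · exact (hux rfl).elim
        · exact ⟨o1 x hx, o2 x hx⟩
        · refine ⟨?_, ?_⟩
          · simpa using congrArg star (o1 u hu)
          · simpa using congrArg star (o2 u hu)
        · exact hV.prop.2 u hu x hx hux
    exact v0 (by rw [← h3, o1 v hmem, zero_mul])
  have hzero' : ∀ a, (e - e') * a * (f - w * star w) = 0 := fun a => by
    have := congrArg star (hzero (star a))
    rwa [star_mul, star_mul, hP.star_self_eq, hQ.star_self_eq, star_star, star_zero,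
      ← mul_assoc] at this
  obtain ⟨c, hc⟩ := hA.exists_isRightSupport (Set.range fun a => (e - e') * a)
  -- The set supported by `c` is a right ideal; with adjoints this makes `c` central.
  have key : ∀ a, c * a * c = c * a := fun a => by
    rw [mul_assoc]
    refine hc.mul_congr ?_
    rintro _ ⟨b, rfl⟩
    simpa [mul_assoc] using hc.mul_eq _ ⟨b * a, rfl⟩
  refine ⟨w, c, hc.proj, fun a => ?_, hfw, ?_, ?_, ?_⟩
  · have h2 := congrArg star (key (star a))
    simp only [star_mul, star_star, hc.proj.star_self_eq] at h2
    rw [← key a, ← h2, mul_assoc]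
  · rw [← hwe, mul_assoc, hee]
  · rw [hsw]
    simpa [hP.mul_self_eq] using hc.mul_eq _ ⟨e - e', rfl⟩
  · refine hc.mul_eq_zero _ ?_
    rintro _ ⟨a, rfl⟩
    exact hzero' a

end Support

/-! ### Commutants, corners and maximal commutative subalgebras. -/

section Subalgebras

variable {A : Type*} [NonUnitalRing A] [StarRing A] [Module ℂ A] [IsScalarTower ℂ A A]
  [SMulCommClass ℂ A A]

theorem IsBaerStar.isBaerStarSubalgebra_centralizer (hA : IsBaerStar A) (T : Set A) :
    IsBaerStarSubalgebra (NonUnitalStarSubalgebra.centralizer ℂ T) := by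
  intro S hS _
  obtain ⟨p, hp⟩ := hA.exists_isRightSupport S
  refine ⟨p, ?_, hp.proj, hp.rightAnnihilator_eq⟩
  rw [NonUnitalStarSubalgebra.mem_centralizer_iff]
  intro t ht
  have h : ∀ s ∈ S, s * t = t * s ∧ s * star t = star t * s := fun s hs => by
    have := (NonUnitalStarSubalgebra.mem_centralizer_iff ℂ).1 (hS hs) t ht
    exact ⟨this.1.symm, this.2.symm⟩
  refine ⟨(hp.commute (fun s hs => (h s hs).1) fun s hs => (h s hs).2).symm,
    (hp.commute (fun s hs => (h s hs).2) fun s hs => ?_).symm⟩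
  rw [star_star]
  exact (h s hs).1

theorem mem_starCorner_iff {e : A} (he : IsStarProjection e) {x : A} :
    x ∈ starCorner e he ↔ e * x * e = x := by
  refine ⟨?_, fun h => ⟨x, h.symm⟩⟩
  rintro ⟨a, rfl⟩
  simp only [mul_assoc, he.mul_mul_self, he.mul_self_eq]

theorem IsBaerStar.isBaerStarSubalgebra_starCorner (hA : IsBaerStar A) {e : A}
    (he : IsStarProjection e) : IsBaerStarSubalgebra (starCorner e he) := by
  intro S hS _
  obtain ⟨p, hp⟩ := hA.exists_isRightSupport S
  have h1 : p * e = p := hp.mul_right_eq fun s hs => by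
    have := (mem_starCorner_iff he).1 (hS hs)
    rw [← this, mul_assoc, he.mul_self_eq]
  have h2 : e * p = p := by
    simpa [he.star_self_eq, hp.proj.star_self_eq] using congrArg star h1
  exact ⟨p, (mem_starCorner_iff he).2 (by rw [h2, h1]), hp.proj, hp.rightAnnihilator_eq⟩

/-- A maximal commutative `*`-subalgebra is its own commutant. -/
theorem IsMaximalCommutative.mem_iff [StarModule ℂ A] {B : NonUnitalStarSubalgebra ℂ A}
    (hB : IsMaximalCommutative B) {x : A} : x ∈ B ↔ ∀ b ∈ B, b * x = x * b := by
  refine ⟨fun hx b hb => hB.prop b hb x hx, fun hx => ?_⟩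
  have key : ∀ y : A, IsSelfAdjoint y → (∀ b ∈ B, b * y = y * b) → y ∈ B := fun y hy hyB => by
    have hcomm : ∀ a ∈ insert y (B : Set A), ∀ b ∈ insert y (B : Set A), a * b = b * a := by
      rintro a (rfl | ha) b (rfl | hb)
      · rfl
      · exact (hyB b hb).symm
      · exact hyB a ha
      · exact hB.prop a ha b hb
    have hstar : star (insert y (B : Set A)) = insert y (B : Set A) := by
      ext a
      rw [Set.mem_star]
      constructor
      · rintro (h | h)
        · left; rw [← star_star a, h]; exact hy
        · right; simpa using star_mem h
      · rintro (rfl | h)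
        · left; exact hy
        · right; exact star_mem h
    -- The bicommutant of a commuting, `*`-closed set is commutative; it contains `B` and `y`, so
    -- maximality puts `y` in `B`.
    let C := NonUnitalStarSubalgebra.centralizer ℂ
      (NonUnitalStarSubalgebra.centralizer ℂ (insert y (B : Set A)) : Set A)
    have hsub : insert y (B : Set A) ⊆ C := fun a ha =>
      (NonUnitalStarAlgebra.adjoin_le_centralizer_centralizer ℂ (insert y (B : Set A)))
        (NonUnitalStarAlgebra.subset_adjoin ℂ _ ha)
    have hC : ∀ a ∈ C, ∀ b ∈ C, a * b = b * a := fun a ha b hb => by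
      have ha' : a ∈ (C : Set A) := ha
      have hb' : b ∈ (C : Set A) := hb
      rw [NonUnitalStarSubalgebra.coe_centralizer_centralizer, hstar, Set.union_self] at ha' hb'
      exact Set.centralizer_centralizer_comm_of_comm hcomm a ha' b hb'
    exact hB.le_of_ge hC (fun b hb => hsub (Set.mem_insert_of_mem _ hb))
      (hsub (Set.mem_insert _ _))
  have hx' : ∀ b ∈ B, b * star x = star x * b := fun b hb => by
    simpa using (congrArg star (hx (star b) (star_mem hb))).symm
  rw [← realPart_add_I_smul_imaginaryPart x]
  refine add_mem (key _ (realPart x).2 fun b hb => ?_)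
    (SMulMemClass.smul_mem Complex.I (key _ (imaginaryPart x).2 fun b hb => ?_))
  · simp only [realPart_apply_coe, mul_smul_comm, smul_mul_assoc, mul_add, add_mul, hx b hb,
      hx' b hb]
  · simp only [imaginaryPart_apply_coe, mul_smul_comm, smul_mul_assoc, mul_sub, sub_mul, hx b hb,
      hx' b hb]

theorem NonUnitalStarSubalgebra.mem_centralizer_coe_iff {B : NonUnitalStarSubalgebra ℂ A} {x : A} :
    x ∈ centralizer ℂ (B : Set A) ↔ ∀ b ∈ B, b * x = x * b := by
  rw [mem_centralizer_iff]
  exact ⟨fun h b hb => (h b hb).1, fun h b hb => ⟨h b hb, h _ (star_mem hb)⟩⟩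

theorem IsMaximalCommutative.centralizer_eq [StarModule ℂ A] {B : NonUnitalStarSubalgebra ℂ A}
    (hB : IsMaximalCommutative B) : NonUnitalStarSubalgebra.centralizer ℂ (B : Set A) = B :=
  SetLike.ext fun _ => NonUnitalStarSubalgebra.mem_centralizer_coe_iff.trans hB.mem_iff.symm

end Subalgebras

/-! ### Functional calculus estimates in a `C*`-algebra. -/

section CStar

variable {M : Type*} [NonUnitalCStarAlgebra M]

theorem norm_cfcₙ_min_le_of_nonneg [PartialOrder M] [StarOrderedRing M] {a : M} (ha : 0 ≤ a)
    {ε : ℝ} (hε : 0 ≤ ε) : ‖cfcₙ (fun t : ℝ => min t ε) a‖ ≤ ε := by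
  refine norm_cfcₙ_le fun t ht => ?_
  have : 0 ≤ t := quasispectrum_nonneg_of_nonneg a ha t ht
  rw [Real.norm_of_nonneg (le_min this hε)]
  exact min_le_right _ _

theorem cfcₙ_min_add_cfcₙ_max_sub {a : M} (ha : IsSelfAdjoint a) {ε : ℝ} (hε : 0 ≤ ε) :
    cfcₙ (fun t : ℝ => min t ε) a + cfcₙ (fun t : ℝ => max (t - ε) 0) a = a := by
  rw [← cfcₙ_add _ _ _ (by fun_prop) (by simp [hε]) (by fun_prop) (by simp [hε])]
  conv_rhs => rw [← cfcₙ_id' ℝ a ha]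
  congr 1
  ext t
  rcases le_total t ε with h | h
  · rw [min_eq_left h, max_eq_right (by linarith), add_zero]
  · rw [min_eq_right h, max_eq_left (by linarith)]; ring

theorem cfcₙ_max_sub_ne_zero [PartialOrder M] [StarOrderedRing M] {a : M} (ha : 0 ≤ a) {ε : ℝ}
    (hε : 0 ≤ ε) (h : ε < ‖a‖) : cfcₙ (fun t : ℝ => max (t - ε) 0) a ≠ 0 := by
  intro h0
  have h1 := cfcₙ_min_add_cfcₙ_max_sub (IsSelfAdjoint.of_nonneg ha) hε
  rw [h0, add_zero] at h1
  have h2 := norm_cfcₙ_min_le_of_nonneg ha hε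
  rw [h1] at h2
  exact h.not_ge h2

/-- The spectrum lies in `[-δ, δ]`, where the clamp is the identity. Truncation is thus harmless in
a factor where the element is already small. -/
theorem cfcₙ_clamp_eq_self {a : M} (ha : IsSelfAdjoint a) {δ : ℝ} (h : ‖a‖ ≤ δ) :
    cfcₙ (fun t : ℝ => max (-δ) (min δ t)) a = a := by
  conv_rhs => rw [← cfcₙ_id' ℝ a ha]
  refine cfcₙ_congr fun t ht => ?_
  have := (NonUnitalIsometricContinuousFunctionalCalculus.norm_quasispectrum_le a ht ha).trans h
  rw [Real.norm_eq_abs, abs_le] at this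
  change max (-δ) (min δ t) = t
  rw [min_eq_right this.2, max_eq_right this.1]

theorem norm_cfcₙ_clamp_le (a : M) {δ : ℝ} (hδ : 0 ≤ δ) :
    ‖cfcₙ (fun t : ℝ => max (-δ) (min δ t)) a‖ ≤ δ :=
  norm_cfcₙ_le fun t _ => by
    rw [Real.norm_eq_abs, abs_le]
    exact ⟨le_max_left _ _, max_le (by linarith) (min_le_left _ _)⟩

theorem IsStarProjection.mul_nonneg_of_commute [PartialOrder M] [StarOrderedRing M] {p a : M}
    (hp : IsStarProjection p) (ha : 0 ≤ a) (h : p * a = a * p) : 0 ≤ p * a := by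
  have := star_left_conjugate_nonneg ha p
  rwa [hp.star_self_eq, mul_assoc, ← h, hp.mul_mul_self] at this

theorem IsStarProjection.mul_le_of_commute [PartialOrder M] [StarOrderedRing M] {p a : M}
    (hp : IsStarProjection p) (ha : 0 ≤ a) (h : p * a = a * p) : p * a ≤ a := by
  rw [← sub_nonneg]
  have h1 := CFC.sqrt_mul_sqrt_self a ha
  have h2 : star (CFC.sqrt a) = CFC.sqrt a := IsSelfAdjoint.of_nonneg (CFC.sqrt_nonneg a)
  -- This element stands for `√a (1 - p)` without a unit.
  have h3 := star_mul_self_nonneg (CFC.sqrt a - CFC.sqrt a * p)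
  have h4 : star (CFC.sqrt a - CFC.sqrt a * p) * (CFC.sqrt a - CFC.sqrt a * p) = a - p * a := by
    rw [star_sub, star_mul, hp.star_self_eq, h2, sub_mul, mul_sub, mul_sub, h1, ← mul_assoc, h1,
      mul_assoc p, h1, mul_assoc p, ← mul_assoc _ _ p, h1, ← h, hp.mul_mul_self]
    abel
  rwa [h4] at h3

/-- If the projection `p` commutes with `0 ≤ z`, `‖z‖ ≤ 3s`, and lies between the spectral
projections of `z` for `[2s, ∞)` and `[s, ∞)`, then `0 ≤ z - s p` and `‖z - s p‖ ≤ 2s`. -/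
theorem nonneg_sub_smul_and_norm_le [PartialOrder M] [StarOrderedRing M] {z p : M} {s : ℝ}
    (hs : 0 < s) (hz : 0 ≤ z) (hzs : ‖z‖ ≤ 3 * s) (hp : IsStarProjection p) (hpz : Commute z p)
    (h1 : p * cfcₙ (fun t : ℝ => max (t - 2 * s) 0) z = cfcₙ (fun t : ℝ => max (t - 2 * s) 0) z)
    (h2 : p * cfcₙ (fun t : ℝ => min (t / s) 1) z = p) :
    0 ≤ z - s • p ∧ ‖z - s • p‖ ≤ 2 * s := by
  have hzsa := IsSelfAdjoint.of_nonneg hz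
  have hspec : ∀ t ∈ quasispectrum ℝ z, 0 ≤ t ∧ t ≤ 3 * s := fun t ht => by
    refine ⟨quasispectrum_nonneg_of_nonneg z hz t ht, (le_abs_self t).trans ?_⟩
    exact (NonUnitalIsometricContinuousFunctionalCalculus.norm_quasispectrum_le z ht hzsa).trans hzs
  have hcomm : ∀ f : ℝ → ℝ, p * cfcₙ f z = cfcₙ f z * p := fun f => (hpz.cfcₙ_real f).symm
  have h3 : s • p = p * cfcₙ (fun t : ℝ => min t s) z := by
    have : cfcₙ (fun t : ℝ => min t s) z = s • cfcₙ (fun t : ℝ => min (t / s) 1) z := by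
      rw [← cfcₙ_const_mul s _ z (by fun_prop) (by simp)]
      congr 1
      ext t
      rw [mul_min_of_nonneg _ _ hs.le, mul_div_cancel₀ _ hs.ne', mul_one]
    rw [this, mul_smul_comm, h2]
  have hj : 0 ≤ cfcₙ (fun t : ℝ => min t s) z :=
    cfcₙ_nonneg fun t ht => le_min (hspec t ht).1 hs.le
  have hzj : cfcₙ (fun t : ℝ => min t s) z ≤ z := by
    conv_rhs => rw [← cfcₙ_id' ℝ z hzsa]
    exact cfcₙ_mono (fun t _ => min_le_left _ _) (by fun_prop) (by fun_prop) (by simp [hs.le])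
  have hnonneg : 0 ≤ z - s • p := by
    rw [sub_nonneg, h3]
    exact (hp.mul_le_of_commute hj (hcomm _)).trans hzj
  refine ⟨hnonneg, (CStarAlgebra.norm_le_norm_of_nonneg_of_le hnonneg ?_).trans
    (norm_cfcₙ_min_le_of_nonneg hz (by positivity : (0 : ℝ) ≤ 2 * s))⟩
  have h4 := cfcₙ_min_add_cfcₙ_max_sub hzsa (by positivity : (0 : ℝ) ≤ 2 * s)
  rw [← sub_nonneg]
  -- Positivity of this difference bounds `z - s p` by `min(z, 2s)`. It reduces to `max(t - 2s, 0) ≤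
  -- min(t, s)`, which holds on `[0, 3s]`.
  have h5 : cfcₙ (fun t : ℝ => min t (2 * s)) z - (z - s • p) =
      p * cfcₙ (fun t : ℝ => min t s - max (t - 2 * s) 0) z := by
    rw [cfcₙ_sub _ _ _ (by fun_prop) (by simp [hs.le]) (by fun_prop) (by simp [hs.le]), mul_sub,
      h1, ← h3, eq_sub_of_add_eq h4]
    abel
  rw [h5]
  refine hp.mul_nonneg_of_commute (cfcₙ_nonneg fun t ht => ?_) (hcomm _)
  obtain ⟨h6, h7⟩ := hspec t ht
  rw [sub_nonneg]
  exact max_le (le_min (by linarith) (by linarith)) (le_min h6 hs.le)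

end CStar

/-! ### Functional calculus and polar decomposition in a projective limit. -/

namespace ProjectiveLimit

variable {A : Type*} [NonUnitalRing A] [StarRing A] [Module ℂ A] [TopologicalSpace A]
  {Λ : Type*} [PartialOrder Λ] {F : Λ → Type*} [∀ α, NonUnitalCStarAlgebra (F α)]
  (D : ProjectiveLimit A F)

theorem ext (D : ProjectiveLimit A F) {x y : A} (h : ∀ α, D.π α x = D.π α y) : x = y :=
  D.isEmbedding.injective (funext h)

theorem continuous_π (α : Λ) : Continuous (D.π α) :=
  continuous_pi_iff.1 D.isEmbedding.continuous α

/-- Connecting `*`-homomorphisms commute with the functional calculus, so the values in the factors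
form a coherent family. -/
theorem exists_cfcₙ {f : ℝ → ℝ} (hf : Continuous f) (h0 : f 0 = 0) {x : A}
    (hx : IsSelfAdjoint x) : ∃ y : A, ∀ α, D.π α y = cfcₙ f (D.π α x) := by
  refine D.exists_lift _ fun α β h => ?_
  rw [NonUnitalStarAlgHom.map_cfcₙ (D.g α β h) f (D.π β x) hf.continuousOn h0
    (D.g_continuous α β h) (hx.map _) ((hx.map _).map _), D.g_π]

open Classical in
/-- The continuous functional calculus of the self-adjoint elements of a projective limit of
`C*`-algebras, for functions that vanish at `0`. -/
noncomputable def fcalc (f : ℝ → ℝ) (x : A) : A :=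
  if h : ∃ y : A, ∀ α, D.π α y = cfcₙ f (D.π α x) then h.choose else 0

theorem π_fcalc {f : ℝ → ℝ} (hf : Continuous f) (h0 : f 0 = 0) {x : A}
    (hx : IsSelfAdjoint x) (α : Λ) : D.π α (D.fcalc f x) = cfcₙ f (D.π α x) := by
  have h := D.exists_cfcₙ hf h0 hx
  rw [fcalc, dif_pos h]
  exact h.choose_spec α

theorem isSelfAdjoint_fcalc {f : ℝ → ℝ} (hf : Continuous f) (h0 : f 0 = 0) {x : A}
    (hx : IsSelfAdjoint x) : IsSelfAdjoint (D.fcalc f x) :=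
  D.ext fun α => by
    rw [map_star, D.π_fcalc hf h0 hx]
    exact cfcₙ_predicate f (D.π α x)

theorem fcalc_mul {f g k : ℝ → ℝ} (hf : Continuous f) (hf0 : f 0 = 0) (hg : Continuous g)
    (hg0 : g 0 = 0) (hk : ∀ t, f t * g t = k t) {x : A} (hx : IsSelfAdjoint x) :
    D.fcalc f x * D.fcalc g x = D.fcalc k x := by
  obtain rfl : (fun t => f t * g t) = k := funext hk
  refine D.ext fun α => ?_
  rw [map_mul, D.π_fcalc hf hf0 hx, D.π_fcalc hg hg0 hx, D.π_fcalc (by fun_prop) (by simp [hf0]) hx,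
    cfcₙ_mul _ _ _ hf.continuousOn hf0 hg.continuousOn hg0]

theorem fcalc_id {x : A} (hx : IsSelfAdjoint x) : D.fcalc (fun t => t) x = x :=
  D.ext fun α => by rw [D.π_fcalc continuous_id' rfl hx, cfcₙ_id' ℝ _ (hx.map _)]

theorem fcalc_commute {f : ℝ → ℝ} (hf : Continuous f) (h0 : f 0 = 0) {x b : A}
    (hx : IsSelfAdjoint x) (hxb : x * b = b * x) : D.fcalc f x * b = b * D.fcalc f x :=
  D.ext fun α => by
    rw [map_mul, map_mul, D.π_fcalc hf h0 hx]
    refine Commute.cfcₙ_real ?_ f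
    rw [Commute, SemiconjBy, ← map_mul, hxb, map_mul]

/-- Polar decomposition away from zero: with `y = x* x`, the element `x y^(-1/2)` makes sense on the
support `g` of a function of `y` vanishing on `(-∞, ε]`. -/
theorem hasPartialIsometries (D : ProjectiveLimit A F) (hA : IsBaerStar A) : HasPartialIsometries A := by
  let _ : ∀ α, PartialOrder (F α) := fun α => CStarAlgebra.spectralOrder (F α)
  have _ : ∀ α, StarOrderedRing (F α) := fun α => CStarAlgebra.spectralOrderedRing (F α)
  rintro e f he hf ⟨a, ha⟩
  set x := f * a * e with hxdef
  set y := star x * x with hydef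
  have hy : IsSelfAdjoint y := IsSelfAdjoint.star_mul_self x
  obtain ⟨α, hα⟩ : ∃ α, D.π α x ≠ 0 := by
    by_contra! h
    exact ha (D.ext fun α => by rw [h α, map_zero])
  have hyα : D.π α y = star (D.π α x) * D.π α x := by rw [hydef, map_mul, map_star]
  have hpos : 0 < ‖D.π α y‖ := by
    rw [hyα, CStarRing.norm_star_mul_self]
    exact mul_pos (norm_pos_iff.2 hα) (norm_pos_iff.2 hα)
  -- Any positive value below the norm keeps `h` of `y` nonzero in the factor `α`.
  set ε := ‖D.π α y‖ / 2 with hεdef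
  have hε : 0 < ε := half_pos hpos
  have hmax : ∀ t : ℝ, 0 < max t ε := fun t => lt_max_of_lt_right hε
  let h : ℝ → ℝ := fun t => max (t - ε) 0
  -- Equal to `t^(-1/2)` for `t ≥ ε`, continued so as to vanish at `0`. Next, `s` is `h` divided by
  -- `t`, so that `h` of `y` is a left multiple of `y` and inherits `y e = y`.
  let k : ℝ → ℝ := fun t => t / (max t ε * √(max t ε))
  let s : ℝ → ℝ := fun t => h t / max t ε
  have hh : Continuous h := by fun_prop
  have hh0 : h 0 = 0 := by simp [h, hε.le]
  have hk : Continuous k := by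
    refine continuous_id.div (by fun_prop) fun t => ?_
    exact (mul_pos (hmax t) (Real.sqrt_pos.2 (hmax t))).ne'
  have hk0 : k 0 = 0 := by simp [k]
  have hs : Continuous s := hh.div (by fun_prop) fun t => (hmax t).ne'
  have hs0 : s 0 = 0 := by simp [s, hh0]
  have hye : y * e = y := by
    rw [hydef, hxdef, mul_assoc, mul_assoc (f * a), he.mul_self_eq]
  have hsy : D.fcalc s y * y = D.fcalc h y := by
    have := D.fcalc_mul hs hs0 continuous_id' rfl (k := h) (fun t => ?_) hy
    · rwa [D.fcalc_id hy] at this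
    rcases le_total t ε with ht | ht
    · simp [s, h, ht]
    · simp only [s, max_eq_left ht]
      exact div_mul_cancel₀ _ (hε.trans_le ht).ne'
  have hkyk : D.fcalc h y * (D.fcalc k y * y * D.fcalc k y) = D.fcalc h y := by
    have h1 := D.fcalc_mul hk hk0 continuous_id' rfl (fun t => rfl) hy
    have h2 := D.fcalc_mul (by fun_prop) (by simp) hk hk0 (fun t => rfl) hy (f := fun t => k t * t)
    have h3 := D.fcalc_mul hh hh0 (by fun_prop) (by simp) (k := h) (fun t => ?_) hy
      (g := fun t => k t * t * k t)
    · rw [D.fcalc_id hy] at h1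
      rw [h1, h2, h3]
    rcases le_total t ε with ht | ht
    · simp [h, ht]
    · have ht0 : 0 < t := hε.trans_le ht
      have h4 : k t * t * k t = 1 := by
        simp only [k, max_eq_left ht]
        have h5 := Real.sqrt_pos.2 ht0
        field_simp
        rw [Real.sq_sqrt ht0.le]
      rw [h4, mul_one]
  have hne : D.fcalc h y ≠ 0 := fun h0 => by
    have h1 := D.π_fcalc hh hh0 hy α
    rw [h0, map_zero] at h1
    refine cfcₙ_max_sub_ne_zero (a := D.π α y) ?_ hε.le (half_lt_self hpos) h1.symm
    rw [hyα]
    exact star_mul_self_nonneg _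
  obtain ⟨g, hg⟩ := hA.exists_isRightSupport {D.fcalc h y}
  have hhg := hg.mul_eq _ rfl
  have hge : g * e = g := hg.mul_right_eq <| by
    rintro _ rfl
    rw [← hsy, mul_assoc, hye]
  have hgk : g * (D.fcalc k y * y * D.fcalc k y) = g := hg.mul_right_eq <| by
    rintro _ rfl
    exact hkyk
  have hvv : star (x * D.fcalc k y * g) * (x * D.fcalc k y * g) = g := by
    rw [star_mul, star_mul, hg.proj.star_self_eq, (D.isSelfAdjoint_fcalc hk hk0 hy).star_eq]
    calc _ = g * (D.fcalc k y * (star x * x) * D.fcalc k y) * g := by simp only [mul_assoc]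
      _ = g := by rw [← hydef, hgk, hg.proj.mul_self_eq]
  refine ⟨x * D.fcalc k y * g, fun h0 => hne ?_, ?_, ?_, ?_⟩
  · rw [h0, mul_zero] at hvv
    rw [← hhg, ← hvv, mul_zero]
  · simp only [hxdef, mul_assoc, hf.mul_mul_self]
  · rw [mul_assoc, hge]
  · rw [mul_assoc, hvv, mul_assoc, hg.proj.mul_self_eq]

end ProjectiveLimit

/-! ### Closed images of commutants, and lifting of central elements. -/

namespace ProjectiveLimit

variable {A : Type*} [NonUnitalRing A] [StarRing A] [Module ℂ A] [TopologicalSpace A]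
  {Λ : Type*} [PartialOrder Λ] {F : Λ → Type*} [∀ α, NonUnitalCStarAlgebra (F α)]
  (D : ProjectiveLimit A F)

/-- A series in `A` that is dominated, in all factors at once, by a convergent series of numbers
has a sum. -/
theorem exists_hasSum {d : ℕ → A} {δ : ℕ → ℝ} (hδ : Summable δ)
    (hd : ∀ β n, ‖D.π β (d n)‖ ≤ δ n) : ∃ y, ∀ β, HasSum (fun n => D.π β (d n)) (D.π β y) := by
  have hsum : ∀ β, Summable fun n => D.π β (d n) := fun β =>
    Summable.of_norm_bounded hδ (hd β)
  obtain ⟨y, hy⟩ := D.exists_lift (fun β => ∑' n, D.π β (d n)) fun α β h => by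
    have h1 := (hsum β).hasSum.map (D.g α β h) (D.g_continuous α β h)
    refine h1.unique ?_
    convert! (hsum α).hasSum using 2 with n
    exact D.g_π α β h _
  exact ⟨y, fun β => by rw [hy]; exact (hsum β).hasSum⟩

theorem exists_isSelfAdjoint_of_mem_closure [StarModule ℂ A] (α : Λ)
    {B : NonUnitalStarSubalgebra ℂ A} {z : F α}
    (hz : IsSelfAdjoint z) (hzB : z ∈ closure (B.map (D.π α) : Set (F α))) {ε : ℝ} (hε : 0 < ε) :
    ∃ b ∈ B, IsSelfAdjoint b ∧ ‖z - D.π α b‖ ≤ ε := by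
  obtain ⟨_, ⟨b, hb, rfl⟩, h⟩ := Metric.mem_closure_iff.1 hzB ε hε
  rw [dist_eq_norm] at h
  refine ⟨(2⁻¹ : ℂ) • (b + star b), SMulMemClass.smul_mem _ (add_mem hb (star_mem hb)), ?_, ?_⟩
  · simp [IsSelfAdjoint, add_comm]
  · change ‖z - D.π α b‖ < ε at h
    have h1 : z - D.π α ((2⁻¹ : ℂ) • (b + star b)) =
        (2⁻¹ : ℂ) • ((z - D.π α b) + star (z - D.π α b)) := by
      rw [star_sub, hz.star_eq, map_smul, map_add, map_star]
      match_scalars <;> norm_num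
    rw [h1, norm_smul]
    have h2 := norm_add_le (z - D.π α b) (star (z - D.π α b))
    rw [norm_star] at h2
    have h3 : ‖(2⁻¹ : ℂ)‖ = 2⁻¹ := by simp
    rw [h3]
    linarith

/-- A positive central element of a factor is approximated by a multiple of the image of a central
projection. -/
theorem exists_central_projection [StarModule ℂ A] [∀ α, PartialOrder (F α)]
    [∀ α, StarOrderedRing (F α)] (hA : IsBaerStar A) {α : Λ} (hπ : Function.Surjective (D.π α))
    {z : F α} (hz : 0 ≤ z)
    (hzc : ∀ b, z * b = b * z) {s : ℝ} (hs : 0 < s) (hzs : ‖z‖ ≤ 3 * s) :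
    ∃ c : A, (∀ a, c * a = a * c) ∧ 0 ≤ z - s • D.π α c ∧ ‖z - s • D.π α c‖ ≤ 2 * s := by
  obtain ⟨x, hx, hxz⟩ : ∃ x, IsSelfAdjoint x ∧ D.π α x = z := by
    obtain ⟨x, hx⟩ := hπ z
    refine ⟨(2⁻¹ : ℂ) • (x + star x), by simp [IsSelfAdjoint, add_comm], ?_⟩
    rw [map_smul, map_add, map_star, hx, (IsSelfAdjoint.of_nonneg hz).star_eq]
    match_scalars
    norm_num
  -- `H` is `1` where `h` is nonzero, and `j` is `1` where `H` is nonzero; this forces `e ≤ q` for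
  -- the supports of `h` and `H`.
  let h : ℝ → ℝ := fun t => max (t - 2 * s) 0
  let H : ℝ → ℝ := fun t => min (max (t / s - 1) 0) 1
  let j : ℝ → ℝ := fun t => min (t / s) 1
  have hh : Continuous h := by fun_prop
  have hh0 : h 0 = 0 := by simp [h, hs.le]
  have hH : Continuous H := by fun_prop
  have hH0 : H 0 = 0 := by simp [H]
  have hj : Continuous j := by fun_prop
  have hj0 : j 0 = 0 := by simp [j]
  have hhH : D.fcalc h x * D.fcalc H x = D.fcalc h x := D.fcalc_mul hh hh0 hH hH0 (fun t => by
    rcases le_total t (2 * s) with ht | ht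
    · simp [h, ht]
    · have h1 : 1 ≤ t / s - 1 := by rw [le_sub_iff_add_le, le_div_iff₀ hs]; linarith
      simp only [H, max_eq_left (zero_le_one.trans h1), min_eq_right h1, mul_one]) hx
  have hHj : D.fcalc H x * D.fcalc j x = D.fcalc H x := D.fcalc_mul hH hH0 hj hj0 (fun t => by
    rcases le_total t s with ht | ht
    · have h1 : t / s - 1 ≤ 0 := by rw [sub_nonpos, div_le_one hs]; exact ht
      simp [H, h1]
    · have h1 : 1 ≤ t / s := by rwa [one_le_div hs]
      simp only [j, min_eq_right h1, mul_one]) hx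
  obtain ⟨u, hu, h1⟩ := hA.exists_unit
  obtain ⟨e, he⟩ := hA.exists_isRightSupport {D.fcalc h x}
  obtain ⟨q, hq⟩ := hA.exists_isRightSupport {D.fcalc H x}
  have heH : e * D.fcalc H x = e := he.mul_right_eq <| by rintro _ rfl; exact hhH
  have hqj : q * D.fcalc j x = q := hq.mul_right_eq <| by rintro _ rfl; exact hHj
  have hHq : D.fcalc H x * q = D.fcalc H x := hq.mul_eq _ rfl
  have heq : e * q = e := by rw [← heH, mul_assoc, hHq]
  obtain ⟨w, c, hc, hcc, hw1, hw2, hc1, hc2⟩ := hA.exists_comparison (D.hasPartialIsometries hA)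
    he.proj (hu.sub_of_mul_eq hq.proj (h1 q).2) (by rw [mul_sub, (h1 e).2, heq, sub_self])
  have hcomm : ∀ b, D.π α (D.fcalc H x) * b = b * D.π α (D.fcalc H x) := fun b => by
    rw [D.π_fcalc hH hH0 hx, hxz]
    exact Commute.cfcₙ_real (hzc b) H
  -- In the factor, `H` of `z` is central, is absorbed by `e` and kills `u - q`, so nothing survives
  -- between the two.
  have hw : D.π α (star w) = 0 := by
    have h2 : star w = e * star w * (u - q) := by
      have h3 := congrArg star hw1
      have h4 := congrArg star hw2
      rw [star_mul, (hu.sub_of_mul_eq hq.proj (h1 q).2).star_self_eq] at h3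
      rw [star_mul, he.proj.star_self_eq] at h4
      rw [h4, h3]
    have h3 : D.π α (D.fcalc H x) * D.π α (u - q) = 0 := by
      rw [← map_mul, mul_sub, (h1 _).2, hHq, sub_self, map_zero]
    rw [h2, ← heH, map_mul, map_mul, map_mul, mul_assoc (D.π α e), hcomm, mul_assoc, mul_assoc, h3,
      mul_zero, mul_zero]
  have hw' : D.π α w = 0 := by
    rw [← star_star w, map_star, hw, star_zero]
  have hec : D.π α e * D.π α c = D.π α e := by
    simpa [hw'] using congrArg (D.π α) hc1
  have hcq : D.π α c * D.π α q = D.π α c := by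
    have := congrArg (D.π α) hc2
    rw [mul_sub, mul_sub, (h1 c).2, map_sub, map_sub, map_mul, map_mul, map_mul, hw', zero_mul,
      mul_zero, sub_zero, map_zero, sub_eq_zero] at this
    exact this.symm
  have hhe : D.fcalc h x * e = D.fcalc h x := he.mul_eq _ rfl
  refine ⟨c, hcc, nonneg_sub_smul_and_norm_le hs hz hzs (hc.map _) (hzc _) ?_ ?_⟩
  · rw [← hxz, ← D.π_fcalc hh hh0 hx, ← map_mul, hcc, map_mul, ← hhe, map_mul, mul_assoc, hec]
  · rw [← hxz, ← D.π_fcalc hj hj0 hx, ← hcq, mul_assoc, ← map_mul, hqj]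

variable [IsScalarTower ℂ A A] [SMulCommClass ℂ A A]

theorem mem_centralizer_iff {T : Set A} {x : A} :
    x ∈ NonUnitalStarSubalgebra.centralizer ℂ T ↔ ∀ t ∈ T, ∀ β,
      D.π β t * D.π β x = D.π β x * D.π β t ∧
        star (D.π β t) * D.π β x = D.π β x * star (D.π β t) := by
  rw [NonUnitalStarSubalgebra.mem_centralizer_iff]
  refine forall₂_congr fun t _ => ⟨fun h β => ?_, fun h => ⟨D.ext fun β => ?_, D.ext fun β => ?_⟩⟩
  · simp only [← map_mul, ← map_star, h, and_self]
  · simp only [map_mul, (h β).1]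
  · simp only [map_mul, map_star, (h β).2]

theorem fcalc_mem_centralizer {T : Set A} {f : ℝ → ℝ} (hf : Continuous f) (h0 : f 0 = 0) {x : A}
    (hx : IsSelfAdjoint x) (hxT : x ∈ NonUnitalStarSubalgebra.centralizer ℂ T) :
    D.fcalc f x ∈ NonUnitalStarSubalgebra.centralizer ℂ T := by
  rw [NonUnitalStarSubalgebra.mem_centralizer_iff] at hxT ⊢
  intro t ht
  exact ⟨(D.fcalc_commute hf h0 hx (hxT t ht).1.symm).symm,
    (D.fcalc_commute hf h0 hx (hxT t ht).2.symm).symm⟩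

variable [StarModule ℂ A]

/-- The image of a commutant under a projection onto a factor is norm closed. -/
theorem isClosed_map_centralizer (α : Λ) (T : Set A) :
    IsClosed ((NonUnitalStarSubalgebra.centralizer ℂ T).map (D.π α) : Set (F α)) := by
  set B := NonUnitalStarSubalgebra.centralizer ℂ T with hB
  have key : ∀ z : F α, IsSelfAdjoint z → z ∈ closure (B.map (D.π α) : Set (F α)) →
      z ∈ B.map (D.π α) := fun z hz hzB => by
    have hex : ∀ n : ℕ, ∃ b ∈ B, IsSelfAdjoint b ∧ ‖z - D.π α b‖ ≤ (1 / 2 : ℝ) ^ n := fun n =>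
      D.exists_isSelfAdjoint_of_mem_closure α hz hzB (by positivity)
    choose b hbB hb hbz using hex
    -- Dominates `2^(-n) + 2^(-(n+1))`, hence the increments of `b` in the factor `α`. Clamping at
    -- `δ n` therefore changes nothing there and bounds them in all other factors.
    set δ : ℕ → ℝ := fun n => 2 * (1 / 2 : ℝ) ^ n with hδ
    have hδ0 : ∀ n, 0 ≤ δ n := fun n => by positivity
    have hδs : Summable δ := summable_geometric_two.mul_left 2
    have hc : ∀ n, Continuous fun t : ℝ => max (-δ n) (min (δ n) t) := fun n => by fun_prop
    have hc0 : ∀ n, max (-δ n) (min (δ n) 0) = 0 := fun n => by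
      rw [min_eq_right (hδ0 n), max_eq_right (by linarith [hδ0 n])]
    have hsub : ∀ n, IsSelfAdjoint (b (n + 1) - b n) := fun n => (hb _).sub (hb _)
    set d : ℕ → A := fun n => D.fcalc (fun t => max (-δ n) (min (δ n) t)) (b (n + 1) - b n) with hd
    have hdB : ∀ n, d n ∈ B := fun n =>
      D.fcalc_mem_centralizer (hc n) (hc0 n) (hsub n) (sub_mem (hbB _) (hbB _))
    have hdα : ∀ n, D.π α (d n) = D.π α (b (n + 1)) - D.π α (b n) := fun n => by
      rw [hd, D.π_fcalc (hc n) (hc0 n) (hsub n), map_sub]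
      refine cfcₙ_clamp_eq_self (((hb _).map _).sub ((hb _).map _)) ?_
      have h1 := norm_sub_le (z - D.π α (b n)) (z - D.π α (b (n + 1)))
      rw [sub_sub_sub_cancel_left] at h1
      refine h1.trans ?_
      have h2 := hbz n
      have h3 := hbz (n + 1)
      have h4 : (1 / 2 : ℝ) ^ (n + 1) ≤ (1 / 2) ^ n :=
        pow_le_pow_of_le_one (by norm_num) (by norm_num) n.le_succ
      simp only [hδ]
      linarith
    obtain ⟨y, hy⟩ := D.exists_hasSum hδs (d := d) fun β n => by
      rw [hd, D.π_fcalc (hc n) (hc0 n) (hsub n)]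
      exact norm_cfcₙ_clamp_le _ (hδ0 n)
    have hyB : y ∈ B := by
      rw [hB, D.mem_centralizer_iff]
      intro t ht β
      have h1 := fun n => D.mem_centralizer_iff.1 (hdB n) t ht β
      constructor
      · refine ((hy β).mul_left (D.π β t)).unique ?_
        simp only [(h1 _).1]
        exact (hy β).mul_right _
      · refine ((hy β).mul_left (star (D.π β t))).unique ?_
        simp only [(h1 _).2]
        exact (hy β).mul_right _
    have hlim : Filter.Tendsto (fun n => D.π α (b n)) Filter.atTop (nhds z) := by
      rw [tendsto_iff_norm_sub_tendsto_zero]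
      refine squeeze_zero (fun _ => norm_nonneg _) (fun n => ?_)
        (tendsto_pow_atTop_nhds_zero_of_lt_one (r := (1 / 2 : ℝ)) (by norm_num) (by norm_num))
      rw [norm_sub_rev]
      exact hbz n
    have hlim2 := (hy α).tendsto_sum_nat
    simp only [hdα, Finset.sum_range_sub (fun n => D.π α (b n))] at hlim2
    have h5 : D.π α y = z - D.π α (b 0) :=
      tendsto_nhds_unique hlim2 (hlim.sub_const _)
    exact ⟨y + b 0, add_mem hyB (hbB 0), by
      change D.π α (y + b 0) = z
      rw [map_add, h5, sub_add_cancel]⟩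
  refine isClosed_of_closure_subset fun z hz => ?_
  have hz' : z ∈ (B.map (D.π α)).topologicalClosure := hz
  rw [SetLike.mem_coe, ← realPart_add_I_smul_imaginaryPart z]
  refine add_mem (key _ (realPart z).2 ?_)
    (SMulMemClass.smul_mem Complex.I (key _ (imaginaryPart z).2 ?_))
  · change _ ∈ (B.map (D.π α)).topologicalClosure
    rw [realPart_apply_coe]
    rw [← Complex.coe_smul]
    exact SMulMemClass.smul_mem _ (add_mem hz' (star_mem hz'))
  · change _ ∈ (B.map (D.π α)).topologicalClosure
    rw [imaginaryPart_apply_coe, ← Complex.coe_smul]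
    exact SMulMemClass.smul_mem _ (SMulMemClass.smul_mem _ (sub_mem hz' (star_mem hz')))

/-- Positive central elements are approximated greedily by combinations of images of central
projections; the image of the center is closed, so the limit lifts. -/
theorem map_center (hA : IsBaerStar A) {α : Λ} (hπ : Function.Surjective (D.π α)) :
    (NonUnitalStarSubalgebra.center ℂ A).map (D.π α) =
      NonUnitalStarSubalgebra.center ℂ (F α) := by
  let _ : ∀ α, PartialOrder (F α) := fun α => CStarAlgebra.spectralOrder (F α)
  have _ : ∀ α, StarOrderedRing (F α) := fun α => CStarAlgebra.spectralOrderedRing (F α)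
  have hclosed : IsClosed ((NonUnitalStarSubalgebra.center ℂ A).map (D.π α) : Set (F α)) := by
    rw [← NonUnitalStarSubalgebra.centralizer_univ]
    exact D.isClosed_map_centralizer α _
  have happrox : ∀ z : F α, 0 ≤ z → (∀ b, z * b = b * z) → ∀ n : ℕ,
      ∃ y ∈ (NonUnitalStarSubalgebra.center ℂ A).map (D.π α), 0 ≤ z - y ∧
        (∀ b, (z - y) * b = b * (z - y)) ∧ ‖z - y‖ ≤ (2 / 3 : ℝ) ^ n * (‖z‖ + 1) := by
    intro z hz hzc n
    induction n with
    | zero => exact ⟨0, zero_mem _, by simpa using hz, by simpa using hzc, by simp⟩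
    | succ n ih =>
      obtain ⟨y, hy, h0, hyc, hn⟩ := ih
      -- A third of the current bound, so that `2 * s` is the next one; the `+ 1` keeps `s` positive
      -- when `z = 0`.
      set s := (2 / 3 : ℝ) ^ n * (‖z‖ + 1) / 3 with hs
      obtain ⟨c, hc, h1, h2⟩ := D.exists_central_projection hA hπ h0 hyc (s := s) (by positivity)
        (by linarith)
      have hcmem : c ∈ NonUnitalStarSubalgebra.center ℂ A :=
        NonUnitalStarSubalgebra.mem_center_iff.2 fun b => (hc b).symm
      have hcπ : ∀ b, D.π α c * b = b * D.π α c := fun b => by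
        obtain ⟨a, rfl⟩ := hπ b
        rw [← map_mul, hc, map_mul]
      refine ⟨y + s • D.π α c, add_mem hy ?_, ?_, fun b => ?_, ?_⟩
      · rw [← Complex.coe_smul]
        exact SMulMemClass.smul_mem _ ⟨c, hcmem, rfl⟩
      · rwa [← sub_sub]
      · rw [← sub_sub, sub_mul, mul_sub, hyc, smul_mul_assoc, mul_smul_comm, hcπ]
      · rw [← sub_sub]
        refine h2.trans (le_of_eq ?_)
        rw [hs, pow_succ]
        ring
  have hpos : ∀ z : F α, 0 ≤ z → (∀ b, z * b = b * z) →
      z ∈ (NonUnitalStarSubalgebra.center ℂ A).map (D.π α) := fun z hz hzc => by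
    choose y hy _ _ hyn using happrox z hz hzc
    refine hclosed.mem_of_tendsto (b := Filter.atTop) (f := y) ?_ (Filter.Eventually.of_forall hy)
    rw [tendsto_iff_norm_sub_tendsto_zero]
    refine squeeze_zero (g := fun n => (2 / 3 : ℝ) ^ n * (‖z‖ + 1)) (fun _ => norm_nonneg _)
      (fun n => by rw [norm_sub_rev]; exact hyn n) ?_
    simpa using (tendsto_pow_atTop_nhds_zero_of_lt_one (r := (2 / 3 : ℝ)) (by norm_num)
      (by norm_num)).mul_const (‖z‖ + 1)
  have hsa : ∀ z : F α, IsSelfAdjoint z → (∀ b, z * b = b * z) →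
      z ∈ (NonUnitalStarSubalgebra.center ℂ A).map (D.π α) := fun z hz hzc => by
    rw [← CFC.posPart_sub_negPart z hz]
    exact sub_mem (hpos _ (CFC.posPart_nonneg z) fun b => Commute.cfcₙ_real (hzc b) _)
      (hpos _ (CFC.negPart_nonneg z) fun b => Commute.cfcₙ_real (hzc b) _)
  refine le_antisymm ?_ fun z hz => ?_
  · rintro _ ⟨c, hc, rfl⟩
    refine NonUnitalStarSubalgebra.mem_center_iff.2 fun b => ?_
    obtain ⟨a, rfl⟩ := hπ b
    change D.π α a * D.π α c = D.π α c * D.π α a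
    rw [← map_mul, NonUnitalStarSubalgebra.mem_center_iff.1 hc, map_mul]
  · have hz1 : ∀ b, z * b = b * z := fun b => (NonUnitalStarSubalgebra.mem_center_iff.1 hz b).symm
    have hz2 : ∀ b, star z * b = b * star z := fun b =>
      (NonUnitalStarSubalgebra.mem_center_iff.1 (star_mem hz) b).symm
    rw [← realPart_add_I_smul_imaginaryPart z]
    refine add_mem (hsa _ (realPart z).2 fun b => ?_)
      (SMulMemClass.smul_mem Complex.I (hsa _ (imaginaryPart z).2 fun b => ?_))
    · simp only [realPart_apply_coe, mul_smul_comm, smul_mul_assoc, mul_add, add_mul, hz1, hz2]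
    · simp only [imaginaryPart_apply_coe, mul_smul_comm, smul_mul_assoc, mul_sub, sub_mul, hz1, hz2]

end ProjectiveLimit

/-! ### Restricting projective limits to subalgebras. -/

namespace ProjectiveLimit

variable {A : Type*} [NonUnitalRing A] [StarRing A] [Module ℂ A] [TopologicalSpace A]
  {Λ : Type*} [PartialOrder Λ] {F : Λ → Type*} [∀ α, NonUnitalCStarAlgebra (F α)]
  (D : ProjectiveLimit A F)

/-- The restriction of a projective limit to subalgebras of the limit and of the factors. -/
def restrict (B : NonUnitalStarSubalgebra ℂ A) (C : ∀ α, NonUnitalStarSubalgebra ℂ (F α))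
    (hg : ∀ α β (h : α ≤ β), ∀ x ∈ C β, D.g α β h x ∈ C α) (hπ : ∀ α, ∀ b ∈ B, D.π α b ∈ C α)
    (hB : ∀ x, (∀ α, D.π α x ∈ C α) → x ∈ B) : ProjectiveLimit B (fun α => C α) where
  g α β h := NonUnitalStarAlgHom.codRestrict
    ((D.g α β h).comp (NonUnitalStarSubalgebraClass.subtype (C β))) (C α) fun x => hg α β h x x.2
  g_continuous α β h := ((D.g_continuous α β h).comp continuous_subtype_val).subtype_mk _
  g_refl α x := Subtype.ext (D.g_refl α x)
  g_comp α β γ h k x := Subtype.ext (D.g_comp α β γ h k x)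
  π α := NonUnitalStarAlgHom.codRestrict
    ((D.π α).comp (NonUnitalStarSubalgebraClass.subtype B)) (C α) fun x => hπ α x x.2
  g_π α β h a := Subtype.ext (D.g_π α β h a)
  isEmbedding := by
    refine Topology.IsEmbedding.of_comp (g := fun (x : (α : Λ) → C α) (α : Λ) => (x α : F α))
      ?_ ?_ ?_
    · exact continuous_pi fun α => ((D.continuous_π α).comp continuous_subtype_val).subtype_mk _
    · exact continuous_pi fun α => continuous_subtype_val.comp (continuous_apply α)
    · exact D.isEmbedding.comp Topology.IsEmbedding.subtypeVal
  exists_lift x hx := by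
    obtain ⟨a, ha⟩ := D.exists_lift (fun α => (x α : F α)) fun α β h =>
      congrArg Subtype.val (hx α β h)
    exact ⟨⟨a, hB a fun α => by rw [ha]; exact (x α).2⟩, fun α => Subtype.ext (ha α)⟩

theorem restrictsTo {B : NonUnitalStarSubalgebra ℂ A} {C : ∀ α, NonUnitalStarSubalgebra ℂ (F α)}
    (hg : ∀ α β (h : α ≤ β), ∀ x ∈ C β, D.g α β h x ∈ C α) (hπ : ∀ α, ∀ b ∈ B, D.π α b ∈ C α)
    (hB : ∀ x, (∀ α, D.π α x ∈ C α) → x ∈ B) : D.RestrictsTo B C :=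
  ⟨D.restrict B C hg hπ hB, fun _ _ _ _ => rfl, fun _ _ => rfl⟩

theorem g_mem_map {B : NonUnitalStarSubalgebra ℂ A} {α β : Λ} (h : α ≤ β) {x : F β}
    (hx : x ∈ B.map (D.π β)) : D.g α β h x ∈ B.map (D.π α) := by
  obtain ⟨b, hb, rfl⟩ := hx
  exact ⟨b, hb, (D.g_π α β h b).symm⟩

theorem commute_of_mem_map {B : NonUnitalStarSubalgebra ℂ A} (hB : IsMaximalCommutative B) {α : Λ}
    {x y : F α} (hx : x ∈ B.map (D.π α)) (hy : y ∈ B.map (D.π α)) : x * y = y * x := by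
  obtain ⟨a, ha, rfl⟩ := hx
  obtain ⟨b, hb, rfl⟩ := hy
  change D.π α a * D.π α b = D.π α b * D.π α a
  rw [← map_mul, hB.prop a ha b hb, map_mul]

theorem g_mem_closure_map {B : NonUnitalStarSubalgebra ℂ A} {α β : Λ} (h : α ≤ β) {x : F β}
    (hx : x ∈ (B.map (D.π β)).topologicalClosure) :
    D.g α β h x ∈ (B.map (D.π α)).topologicalClosure :=
  map_mem_closure (D.g_continuous α β h) hx fun _ => D.g_mem_map h

end ProjectiveLimit

/-- A `*`-subalgebra of a locally `C*`-algebra that is determined by the closures of its images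
in the factors is a locally `C*`-algebra. -/
theorem ProjectiveLimit.isLocallyCStar {A : Type u} [NonUnitalRing A] [StarRing A] [Module ℂ A]
    [TopologicalSpace A] {Λ : Type u} [PartialOrder Λ] [IsDirectedOrder Λ] {F : Λ → Type u}
    [∀ α, NonUnitalCStarAlgebra (F α)] (D : ProjectiveLimit A F) {B : NonUnitalStarSubalgebra ℂ A}
    (hB : ∀ x, (∀ α, D.π α x ∈ (B.map (D.π α)).topologicalClosure) → x ∈ B) :
    IsLocallyCStar B := by
  -- The images of `B` need not be closed here; their closures serve as the `C*`-factors.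
  have hc : ∀ α, IsClosed ((B.map (D.π α)).topologicalClosure : Set (F α)) := fun α =>
    NonUnitalStarSubalgebra.isClosed_topologicalClosure _
  exact ⟨Λ, inferInstance, inferInstance, fun α => (B.map (D.π α)).topologicalClosure,
    fun α => NonUnitalStarSubalgebra.nonUnitalCStarAlgebra (h_closed := hc α) _,
    ⟨D.restrict B _ (fun _ _ h _ => D.g_mem_closure_map h)
      (fun α b hb => subset_closure ⟨b, hb, rfl⟩) hB⟩⟩

section

variable {A : Type u} [NonUnitalRing A] [StarRing A] [Module ℂ A] [IsScalarTower ℂ A A]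
  [SMulCommClass ℂ A A] [TopologicalSpace A]

/-- Commuting with the components of `t` and of its adjoint is a closed condition in each factor, so
a commutant is determined by the closures of its images. -/
theorem IsLocallyAWStar.centralizer [StarModule ℂ A] (hA : IsLocallyAWStar A) (T : Set A) :
    IsLocallyAWStarSubalgebra (NonUnitalStarSubalgebra.centralizer ℂ T) := by
  refine ⟨?_, hA.2.isBaerStarSubalgebra_centralizer T⟩
  obtain ⟨⟨Λ, _, _, F, _, ⟨D⟩⟩, -⟩ := hA
  refine D.isLocallyCStar fun x hx => ?_
  rw [D.mem_centralizer_iff]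
  intro t ht β
  refine closure_minimal (t := {y | D.π β t * y = y * D.π β t ∧
    star (D.π β t) * y = y * star (D.π β t)}) ?_ ?_ (hx β)
  · rintro _ ⟨b, hb, rfl⟩
    exact D.mem_centralizer_iff.1 hb t ht β
  · exact (isClosed_eq (by fun_prop) (by fun_prop)).inter (isClosed_eq (by fun_prop) (by fun_prop))

theorem ProjectiveLimit.mem_starCorner_iff {Λ : Type*} [PartialOrder Λ] {F : Λ → Type*}
    [∀ α, NonUnitalCStarAlgebra (F α)] (D : ProjectiveLimit A F) {e : A} (he : IsStarProjection e)
    {x : A} : x ∈ starCorner e he ↔ ∀ α, D.π α x ∈ starCorner (D.π α e) (he.map (D.π α)) := by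
  simp only [_root_.mem_starCorner_iff, ← map_mul]
  exact ⟨fun h α => by rw [h], D.ext⟩

theorem isClosed_starCorner {M : Type*} [NonUnitalCStarAlgebra M] {e : M}
    (he : IsStarProjection e) : IsClosed (starCorner e he : Set M) := by
  have : (starCorner e he : Set M) = {x | e * x * e = x} := Set.ext fun x => mem_starCorner_iff he
  rw [this]
  exact isClosed_eq (by fun_prop) continuous_id

theorem isClosed_centralizer {M : Type*} [NonUnitalCStarAlgebra M] (T : Set M) :
    IsClosed (NonUnitalStarSubalgebra.centralizer ℂ T : Set M) := by
  rw [NonUnitalStarSubalgebra.coe_centralizer]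
  exact Set.isClosed_centralizer _

theorem IsAWStar.centralizer {M : Type*} [NonUnitalCStarAlgebra M] (hM : IsAWStar M) (T : Set M) :
    IsAWStarSubalgebra (NonUnitalStarSubalgebra.centralizer ℂ T) :=
  ⟨isClosed_centralizer T, IsBaerStar.isBaerStarSubalgebra_centralizer hM T⟩

theorem IsLocallyAWStar.starCorner [StarModule ℂ A] (hA : IsLocallyAWStar A) {e : A}
    (he : IsStarProjection e) :
    IsLocallyAWStarSubalgebra (starCorner e he) := by
  refine ⟨?_, hA.2.isBaerStarSubalgebra_starCorner he⟩
  obtain ⟨⟨Λ, _, _, F, _, ⟨D⟩⟩, -⟩ := hA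
  refine D.isLocallyCStar fun x hx => (D.mem_starCorner_iff he).2 fun α => ?_
  refine closure_minimal ?_ (isClosed_starCorner _) (hx α)
  rintro _ ⟨b, hb, rfl⟩
  exact (D.mem_starCorner_iff he).1 hb α

end

/-! ### Centers, corners and maximal commutative subalgebras as projective limits. -/

namespace ProjectiveLimit

variable {A : Type*} [NonUnitalRing A] [StarRing A] [Module ℂ A] [IsScalarTower ℂ A A]
  [SMulCommClass ℂ A A] [TopologicalSpace A]
  {Λ : Type*} [PartialOrder Λ] {F : Λ → Type*} [∀ α, NonUnitalCStarAlgebra (F α)]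
  (D : ProjectiveLimit A F)

/-- Surjectivity onto the factors makes the connecting maps surjective, so they carry centers into
centers. -/
theorem restrictsTo_center (hπ : ∀ α, Function.Surjective (D.π α)) :
    D.RestrictsTo (NonUnitalStarSubalgebra.center ℂ A)
      (fun α => NonUnitalStarSubalgebra.center ℂ (F α)) := by
  refine D.restrictsTo (fun α β h x hx => ?_) (fun α b hb => ?_) fun x hx => ?_
  · refine NonUnitalStarSubalgebra.mem_center_iff.2 fun y => ?_
    obtain ⟨a, rfl⟩ := hπ α y
    rw [← D.g_π α β h, ← map_mul, NonUnitalStarSubalgebra.mem_center_iff.1 hx, map_mul]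
  · refine NonUnitalStarSubalgebra.mem_center_iff.2 fun y => ?_
    obtain ⟨a, rfl⟩ := hπ α y
    rw [← map_mul, NonUnitalStarSubalgebra.mem_center_iff.1 hb, map_mul]
  · refine NonUnitalStarSubalgebra.mem_center_iff.2 fun y => D.ext fun α => ?_
    rw [map_mul, map_mul, NonUnitalStarSubalgebra.mem_center_iff.1 (hx α)]

theorem map_starCorner {e : A} (he : IsStarProjection e) {α : Λ}
    (hπ : Function.Surjective (D.π α)) :
    (starCorner e he).map (D.π α) = starCorner (D.π α e) (he.map (D.π α)) := by
  ext x
  constructor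
  · rintro ⟨a, ha, rfl⟩
    exact (D.mem_starCorner_iff he).1 ha α
  · rintro ⟨y, rfl⟩
    obtain ⟨a, rfl⟩ := hπ y
    refine ⟨e * a * e, ⟨a, rfl⟩, ?_⟩
    change D.π α (e * a * e) = _
    rw [map_mul, map_mul]

theorem restrictsTo_starCorner {e : A} (he : IsStarProjection e) :
    D.RestrictsTo (starCorner e he) (fun α => starCorner (D.π α e) (he.map (D.π α))) := by
  refine D.restrictsTo (fun α β h x hx => ?_) (fun α b hb => (D.mem_starCorner_iff he).1 hb α)
    fun x hx => (D.mem_starCorner_iff he).2 hx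
  obtain ⟨a, rfl⟩ := hx
  exact ⟨D.g α β h a, by rw [map_mul, map_mul, D.g_π]⟩

variable [StarModule ℂ A]

/-- Membership in a maximal commutative `*`-subalgebra can be tested in the factors. -/
theorem mem_of_π_commute {B : NonUnitalStarSubalgebra ℂ A} (hB : IsMaximalCommutative B) {x : A}
    (h : ∀ α, ∀ b ∈ B, D.π α b * D.π α x = D.π α x * D.π α b) : x ∈ B :=
  hB.mem_iff.2 fun b hb => D.ext fun α => by rw [map_mul, map_mul, h α b hb]

theorem restrictsTo_map {B : NonUnitalStarSubalgebra ℂ A} (hB : IsMaximalCommutative B) :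
    D.RestrictsTo B (fun α => B.map (D.π α)) :=
  D.restrictsTo (fun _ _ h _ => D.g_mem_map h) (fun _ b hb => ⟨b, hb, rfl⟩) fun _ hx =>
    D.mem_of_π_commute hB fun α b hb => D.commute_of_mem_map hB ⟨b, hb, rfl⟩ (hx α)

theorem restrictsTo_centralizer {B : NonUnitalStarSubalgebra ℂ A} (hB : IsMaximalCommutative B) :
    D.RestrictsTo B
      (fun α => NonUnitalStarSubalgebra.centralizer ℂ (B.map (D.π α) : Set (F α))) := by
  refine D.restrictsTo (fun α β h x hx => ?_) (fun α b hb => ?_) fun x hx => ?_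
  · rw [NonUnitalStarSubalgebra.mem_centralizer_coe_iff] at hx ⊢
    rintro _ ⟨b, hb, rfl⟩
    change D.π α b * _ = _ * D.π α b
    rw [← D.g_π α β h, ← map_mul, hx (D.π β b) ⟨b, hb, rfl⟩, map_mul]
  · exact NonUnitalStarSubalgebra.mem_centralizer_coe_iff.2 fun y hy =>
      D.commute_of_mem_map hB hy ⟨b, hb, rfl⟩
  · exact D.mem_of_π_commute hB fun α b hb =>
      NonUnitalStarSubalgebra.mem_centralizer_coe_iff.1 (hx α) _ ⟨b, hb, rfl⟩

end ProjectiveLimit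

theorem theorem2 (A : Type u) [NonUnitalRing A] [StarRing A] [Module ℂ A]
    [IsScalarTower ℂ A A] [SMulCommClass ℂ A A] [StarModule ℂ A] [TopologicalSpace A]
    (hA : IsLocallyAWStar A) :
    -- the center, the maximal commutative subalgebras and the corners
    (IsLocallyAWStarSubalgebra (NonUnitalStarSubalgebra.center ℂ A) ∧
      (∀ B : NonUnitalStarSubalgebra ℂ A, IsMaximalCommutative B → IsLocallyAWStarSubalgebra B) ∧
      (∀ (e : A) (he : IsStarProjection e), IsLocallyAWStarSubalgebra (starCorner e he))) ∧
    -- their realization as projective limits, for each Arens-Michael decomposition of `A`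
    ∀ (Λ : Type v) [PartialOrder Λ] [IsDirectedOrder Λ] (F : Λ → Type w)
      [∀ α, NonUnitalCStarAlgebra (F α)] (D : ProjectiveLimit A F),
      (∀ α, Function.Surjective (D.π α)) →
      -- the center
      ((∀ α, (NonUnitalStarSubalgebra.center ℂ A).map (D.π α) =
            NonUnitalStarSubalgebra.center ℂ (F α)) ∧
        (∀ α, IsAWStar (F α) → IsAWStarSubalgebra (NonUnitalStarSubalgebra.center ℂ (F α))) ∧
        D.RestrictsTo (NonUnitalStarSubalgebra.center ℂ A)
          (fun α => NonUnitalStarSubalgebra.center ℂ (F α))) ∧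
      -- the maximal commutative subalgebras
      (∀ B : NonUnitalStarSubalgebra ℂ A, IsMaximalCommutative B →
        (∀ α, IsClosed (B.map (D.π α) : Set (F α))) ∧
        D.RestrictsTo B (fun α => B.map (D.π α)) ∧
        (∀ α, IsAWStar (F α) → IsAWStarSubalgebra
          (NonUnitalStarSubalgebra.centralizer ℂ (B.map (D.π α) : Set (F α)))) ∧
        D.RestrictsTo B
          (fun α => NonUnitalStarSubalgebra.centralizer ℂ (B.map (D.π α) : Set (F α))) ∧
        ∀ C : ∀ α, NonUnitalStarSubalgebra ℂ (F α),
          (∀ α, IsMaximalCommutative (C α) ∧ B.map (D.π α) ≤ C α) →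
          (∀ α, IsAWStar (F α) → IsAWStarSubalgebra (C α)) ∧
          ∀ x : A, x ∈ B ↔ ∀ α, D.π α x ∈ C α) ∧
      -- the corners
      (∀ (e : A) (he : IsStarProjection e),
        (∀ α, (starCorner e he).map (D.π α) = starCorner (D.π α e) (he.map (D.π α))) ∧
        (∀ α, IsAWStar (F α) →
          IsAWStarSubalgebra (starCorner (D.π α e) (he.map (D.π α)))) ∧
        D.RestrictsTo (starCorner e he)
          (fun α => starCorner (D.π α e) (he.map (D.π α)))) := by
  refine ⟨⟨?_, fun B hB => ?_, fun e he => hA.starCorner he⟩, ?_⟩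
  · rw [← NonUnitalStarSubalgebra.centralizer_univ]
    exact hA.centralizer _
  · rw [← hB.centralizer_eq]
    exact hA.centralizer _
  intro Λ _ _ F _ D hπ
  refine ⟨⟨fun α => D.map_center hA.2 (hπ α), fun α hα => ?_, D.restrictsTo_center hπ⟩,
    fun B hB => ⟨fun α => ?_, D.restrictsTo_map hB, fun α hα => hα.centralizer _,
      D.restrictsTo_centralizer hB, fun C hC => ⟨fun α hα => ?_, fun x => ?_⟩⟩,
    fun e he => ⟨fun α => D.map_starCorner he (hπ α), fun α hα =>
      ⟨isClosed_starCorner _, IsBaerStar.isBaerStarSubalgebra_starCorner hα _⟩,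
      D.restrictsTo_starCorner he⟩⟩
  · rw [← NonUnitalStarSubalgebra.centralizer_univ]
    exact hα.centralizer _
  · rw [← hB.centralizer_eq]
    exact D.isClosed_map_centralizer α _
  · rw [← (hC α).1.centralizer_eq]
    exact hα.centralizer _
  -- The chosen `C α` need not be compatible with the connecting maps; it is enough that each is
  -- commutative and contains the image of `B`.
  · refine ⟨fun hx α => (hC α).2 ⟨x, hx, rfl⟩, fun hx => D.mem_of_π_commute hB fun α b hb => ?_⟩
    exact (hC α).1.prop _ ((hC α).2 ⟨b, hb, rfl⟩) _ (hx α)
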